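/- Let $S$ be a finite set and let $\Gamma$ be a connected Coxeter graph with vertex set $S$ and Coxeter matrix $(m_{s,t})_{s,t\in S}$, of small type: $m_{s,t}\in\{2,3\}$ for all distinct $s,t\in S$ (with $s,t$ joined by an edge iff $m_{s,t}=3$). Let $$A(\Gamma)=\langle \sigma_s\ (s\in S)\mid \sigma_s\sigma_t=\sigma_t\sigma_s \text{ if } m_{s,t}=2,\ \ \sigma_s\sigma_t\sigma_s=\sigma_t\sigma_s\sigma_t \text{ if } m_{s,t}=3\rangle$$ be its Artin group, and let $H(\Gamma)=\langle T_s\ (s\in S)\mid T_sT_t=T_tT_s \text{ if } m_{s,t}=2\rangle$. Given integers $m_s\ge 2$ $(s\in S)$, let $f:H(\Gamma)\to A(\Gamma)$ be the homomorphism with $f(T_s)=\sigma_s^{m_s}$. An expression is a finite sequence $W=(T_{s_\ell}^{p_\ell},\dots,T_{s_1}^{p_1})$ with $s_i\in S$ and $p_i\in\mathbb Z\setminus\{0\}$; its length is $\ell$, and it is an expression for $w=T_{s_\ell}^{p_\ell}\cdots T_{s_1}^{p_1}\in H(\Gamma)$. An elementary $M$-operation either (I) replaces two adjacent terms $T_s^{p},T_s^{q}$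 with the same $s$ by the single term $T_s^{p+q}$ if $p+q\ne0$, and deletes them if $p+q=0$, or (II) exchanges two adjacent terms $T_s^p,T_t^q$ with $m_{s,t}=2$. An expression is $M$-reduced if no sequence of elementary $M$-operations makes it shorter, and nontrivial if its length is positive. (1) For every choice of integers $m_s\ge 2$: if $w\in H(\Gamma)$ has a nontrivial $M$-reduced expression, then $f(w)\ne 1$. (2) For every choice of integers $m_s\ge 2$, the homomorphism $f$ is injective. (3) Consequently, for every choice of integers $m_s\ge2$, the elements $\sigma_s^{m_s}$ $(s\in S)$ generate a subgroup of $A(\Gamma)$ with presentation $\langle T_s\ (s\in S)\mid T_sT_t=T_tT_s\text{ if }m_{s,t}=2\rangle$, where $T_s$ corresponds to $\sigma_s^{m_s}$. In particular (the Tits conjecture for these groups), the squares $\sigma_s^2$ $(s\in S)$ generate a subgroup with presentation $\langle Q_s\ (s\in S)\mid Q_sQ_t=Q_tQ_s\text{ if }m_{s,t}=2\rangle$, where $Q_s$ corresponds to $\sigma_s^2$. -/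

import Mathlib

namespace ArtinTits

/-- The alternating product `prod(a, b; m) = a b a ⋯` with `m` factors. -/
def altProd {G : Type*} [Group G] (a b : G) (m : ℕ) : G :=
  if Even m then (a * b) ^ (m / 2) else (a * b) ^ ((m - 1) / 2) * a

/-- The Coxeter graph of a Coxeter matrix (the labels are the entries of the matrix; as everywhere
in Mathlib, the entry `0` of a `CoxeterMatrix` stands for `∞`). -/
def coxeterGraph {S : Type*} (M : CoxeterMatrix S) : SimpleGraph S where
  Adj s t := s ≠ t ∧ M s t ≠ 2
  symm := ⟨fun s t h => ⟨h.1.symm, by rw [M.symmetric t s]; exact h.2⟩⟩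
  loopless := ⟨fun _ h => h.1 rfl⟩

/-- Small type: all off-diagonal entries are `2` or `3`. -/
def IsSmallType {S : Type*} (M : CoxeterMatrix S) : Prop :=
  ∀ s t : S, s ≠ t → M s t = 2 ∨ M s t = 3

/-- The relators `prod(σ_s, σ_t; m_{s,t}) prod(σ_t, σ_s; m_{s,t})⁻¹` with `m_{s,t} ≠ ∞`. -/
def artinRels {S : Type*} (M : CoxeterMatrix S) : Set (FreeGroup S) :=
  {r | ∃ s t : S, M s t ≠ 0 ∧
    r = altProd (FreeGroup.of s) (FreeGroup.of t) (M s t) *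
      (altProd (FreeGroup.of t) (FreeGroup.of s) (M s t))⁻¹}

/-- The Artin group `A(Γ)`. -/
abbrev ArtinGroup {S : Type*} (M : CoxeterMatrix S) : Type _ :=
  PresentedGroup (artinRels M)

/-- The standard generator `σ_s` of `A(Γ)`. -/
def sigma {S : Type*} (M : CoxeterMatrix S) (s : S) : ArtinGroup M :=
  PresentedGroup.of s

/-- The relators `T_s T_t (T_t T_s)⁻¹` with `m_{s,t} = 2`. -/
def commRels {S : Type*} (M : CoxeterMatrix S) : Set (FreeGroup S) :=
  {r | ∃ s t : S, M s t = 2 ∧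
    r = (FreeGroup.of s * FreeGroup.of t) * (FreeGroup.of t * FreeGroup.of s)⁻¹}

/-- The group `H(Γ) = ⟨T_s (s ∈ S) ∣ T_s T_t = T_t T_s whenever m_{s,t} = 2⟩`. -/
abbrev HGroup {S : Type*} (M : CoxeterMatrix S) : Type _ :=
  PresentedGroup (commRels M)

/-- The generator `T_s` of `H(Γ)`. -/
def genT {S : Type*} (M : CoxeterMatrix S) (s : S) : HGroup M :=
  PresentedGroup.of s

theorem sigma_commute {S : Type*} (M : CoxeterMatrix S) {s t : S} (h : M s t = 2) :
    Commute (sigma M s) (sigma M t) := by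
  have key : PresentedGroup.mk (artinRels M)
      ((FreeGroup.of s * FreeGroup.of t) * (FreeGroup.of t * FreeGroup.of s)⁻¹) = 1 := by
    apply PresentedGroup.one_of_mem
    refine ⟨s, t, by omega, ?_⟩
    simp [altProd, h]
  rw [map_mul, map_inv, mul_inv_eq_one, map_mul, map_mul] at key
  exact key

/-- The homomorphism `f : H(Γ) → A(Γ)`, `T_s ↦ σ_s ^ m_s`. -/
def powHom {S : Type*} (M : CoxeterMatrix S) (m : S → ℕ) : HGroup M →* ArtinGroup M :=
  PresentedGroup.toGroup (f := fun s => sigma M s ^ m s) (by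
    rintro r ⟨s, t, h, rfl⟩
    rw [map_mul, map_inv, mul_inv_eq_one, map_mul, map_mul, FreeGroup.lift_apply_of,
      FreeGroup.lift_apply_of]
    exact ((sigma_commute M h).pow_pow (m s) (m t)).eq)

theorem powHom_genT {S : Type*} (M : CoxeterMatrix S) (m : S → ℕ) (s : S) :
    powHom M m (genT M s) = sigma M s ^ m s :=
  PresentedGroup.toGroup.of _

/-- An expression: a finite sequence of syllables `T_s ^ p` with `p` a nonzero integer, written
from left to right. -/
abbrev Expression (S : Type*) : Type _ := List (S × {p : ℤ // p ≠ 0})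

/-- The element `[W]` of `H(Γ)` that an expression `W` represents. -/
def Expression.eval {S : Type*} (M : CoxeterMatrix S) (W : Expression S) : HGroup M :=
  (W.map fun x => genT M x.1 ^ (x.2 : ℤ)).prod

/-- `ElemOp M W W'`: the expression `W'` is obtained from `W` by one elementary `M`-operation. -/
inductive ElemOp {S : Type*} (M : CoxeterMatrix S) : Expression S → Expression S → Prop
  /-- Type I: two adjacent syllables in the same generator are merged. -/
  | merge (U V : Expression S) (s : S) (p q : {p : ℤ // p ≠ 0}) (h : (p : ℤ) + q ≠ 0) :
      ElemOp M (U ++ (s, p) :: (s, q) :: V) (U ++ (s, ⟨(p : ℤ) + q, h⟩) :: V)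
  /-- Type I: two adjacent mutually inverse syllables are deleted. -/
  | cancel (U V : Expression S) (s : S) (p q : {p : ℤ // p ≠ 0}) (h : (p : ℤ) + q = 0) :
      ElemOp M (U ++ (s, p) :: (s, q) :: V) (U ++ V)
  /-- Type II: two adjacent syllables in generators with `m_{s,t} = 2` are exchanged. -/
  | swap (U V : Expression S) (s t : S) (p q : {p : ℤ // p ≠ 0}) (h : M s t = 2) :
      ElemOp M (U ++ (s, p) :: (t, q) :: V) (U ++ (t, q) :: (s, p) :: V)

/-- `W` is `M`-reduced: no sequence of elementary `M`-operations leads to a shorter expression. -/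
def Expression.IsMReduced {S : Type*} (M : CoxeterMatrix S) (W : Expression S) : Prop :=
  ∀ W' : Expression S, Relation.ReflTransGen (ElemOp M) W W' → W.length ≤ W'.length

end ArtinTits

/-! The Artin group acts on a free group as Dehn twists act on paths. Each vertex `s` has a circle;
two circles cross once if `m_{s,t} = 3` and are disjoint if `m_{s,t} = 2`; `σ_s` acts by the twist
along the circle of `s`. The model is purely combinatorial: a circle is a cyclic word of half-arcs,
and the `k`-th power of a twist inserts the `k`-th power of a loop, up to sign, wherever a half-arc
ends at or leaves the crossing. Twists along disjoint circles commute (`twist_commute`), those along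
crossing circles satisfy the braid relation (`twist_braid`), and `artinAction` results.

The property followed through the action is `Passes`: a reduced word runs through a given point of a
given circle. A twist along the circle of `s` preserves a pass at a point `u ≠ s` of another circle,
because letters of the circle of `s` are all it inserts and no new cancellation arises between the
other letters (`isReduced_cons_flank`, `passes_twist`). At a crossing with the circle of `s`, a
power `|k| ≥ 2` winds at least twice around that circle, so the image passes through all of its
points, including the base point that a single turn misses (`passes_twist_of_crosses`). This is
where `m_s ≥ 2` enters.

In an `M`-reduced expression two syllables of the same generator are separated by one that does not
commute with them, that is, by a crossing circle. Inductively, some test arc is carried to a word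
passing through the circle of the leftmost generator (`exists_passes_exprEnd`). The test arc has no
such pass, so `f(w) ≠ 1`; injectivity follows because every element has an `M`-reduced expression.
-/

namespace FreeGroup

/-! ### Reduced words under endomorphisms inserting words of a subalphabet -/

section Words

variable {α : Type*}

theorem isReduced_cons_of_forall_mem {C : Set α} {y : α × Bool} (hy : y.1 ∉ C)
    {w : List (α × Bool)} (hw : IsReduced w) (h : ∀ z ∈ w, z.1 ∈ C) : IsReduced (y :: w) := by
  cases w with
  | nil => exact IsReduced.singleton
  | cons z w =>
    exact isReduced_cons_cons.2 ⟨fun e => absurd (h z (by simp)) (e ▸ hy), hw⟩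

theorem isReduced_append_cons {C : Set α} {y : α × Bool} (hy : y.1 ∉ C) {w v : List (α × Bool)}
    (hw : IsReduced w) (h : ∀ z ∈ w, z.1 ∈ C) (hv : IsReduced (y :: v)) :
    IsReduced (w ++ y :: v) := by
  refine List.isChain_append.2 ⟨hw, hv, ?_⟩
  intro a ha b hb e
  simp only [List.head?_cons, Option.mem_def, Option.some.injEq] at hb
  subst hb
  exact absurd (h a (List.mem_of_getLast? ha)) (e ▸ hy)

/-- The endomorphism `x ↦ l x * x * r x` of the free group. -/
def flank (l r : α → FreeGroup α) : FreeGroup α →* FreeGroup α :=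
  lift fun x => l x * of x * r x

/-- The left factor that `flank l r` attaches to a signed letter. -/
def flankL (l r : α → FreeGroup α) (y : α × Bool) : FreeGroup α :=
  if y.2 then l y.1 else (r y.1)⁻¹

/-- The right factor that `flank l r` attaches to a signed letter. -/
def flankR (l r : α → FreeGroup α) (y : α × Bool) : FreeGroup α :=
  if y.2 then r y.1 else (l y.1)⁻¹

theorem flank_mk_singleton (l r : α → FreeGroup α) (y : α × Bool) :
    flank l r (mk [y]) = flankL l r y * mk [y] * flankR l r y := by
  obtain ⟨x, b⟩ := y
  cases b
  · have : (mk [(x, false)] : FreeGroup α) = (of x)⁻¹ := by simp [of, inv_mk, invRev]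
    simp [this, flank, flankL, flankR, mul_assoc]
  · change lift _ (of x) = _ * of x * _
    simp [flankL, flankR]

theorem flank_of (l r : α → FreeGroup α) (x : α) :
    flank l r (of x) = l x * of x * r x := by
  simp [flank]

theorem mk_cons (y : α × Bool) (w : List (α × Bool)) :
    (mk (y :: w) : FreeGroup α) = mk [y] * mk w := by rw [mul_mk]; rfl

theorem isReduced_map_true (P : List α) : IsReduced (P.map fun x => (x, true)) := by
  induction P with
  | nil => exact IsReduced.nil
  | cons x P ih =>
    cases P with
    | nil => exact IsReduced.singleton
    | cons y P => exact isReduced_cons_cons.2 ⟨fun _ => rfl, ih⟩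

variable [DecidableEq α]

theorem IsReduced.toWord_mk {w : List (α × Bool)} (h : IsReduced w) : (mk w).toWord = w := by
  rw [FreeGroup.toWord_mk, h.reduce_eq]

/-- The elements of the free group all of whose letters lie in `C`. -/
def supportedOn (C : Set α) : Subgroup (FreeGroup α) where
  carrier := {g | ∀ y ∈ g.toWord, y.1 ∈ C}
  one_mem' := by simp
  mul_mem' {g h} hg hh y hy := by
    rcases List.mem_append.1 ((toWord_mul_sublist g h).subset hy) with h' | h'
    exacts [hg y h', hh y h']
  inv_mem' {g} hg y hy := by
    rw [toWord_inv] at hy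
    simp only [invRev, List.mem_reverse, List.mem_map] at hy
    obtain ⟨z, hz, rfl⟩ := hy
    exact hg z hz

theorem mk_singleton_mem_supportedOn {C : Set α} {y : α × Bool} (h : y.1 ∈ C) :
    mk [y] ∈ supportedOn C := by
  intro z hz
  rw [IsReduced.singleton.toWord_mk, List.mem_singleton] at hz
  rwa [hz]

theorem of_mem_supportedOn {C : Set α} {x : α} (h : x ∈ C) : of x ∈ supportedOn C :=
  mk_singleton_mem_supportedOn (y := (x, true)) h

/-- A junction `y · g` without cancellation, `y` a letter outside of `C`, stays without
cancellation under an endomorphism `flank l r` whose factors are supported on `C`. -/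
theorem isReduced_cons_flank {C : Set α} {l r : α → FreeGroup α}
    (hl : ∀ x, l x ∈ supportedOn C) (hr : ∀ x, r x ∈ supportedOn C)
    (hlC : ∀ x ∈ C, l x = 1) (hrC : ∀ x ∈ C, r x = 1)
    (w : List (α × Bool)) (hw : IsReduced w) (y : α × Bool) (hy : y.1 ∉ C)
    (B : FreeGroup α) (hB : B ∈ supportedOn C) (h : IsReduced (y :: (B * mk w).toWord)) :
    IsReduced (y :: (flankR l r y * B * flank l r (mk w)).toWord) := by
  have hL : ∀ y, flankL l r y ∈ supportedOn C := fun y => by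
    unfold flankL; split_ifs
    exacts [hl _, inv_mem (hr _)]
  have hR : ∀ y, flankR l r y ∈ supportedOn C := fun y => by
    unfold flankR; split_ifs
    exacts [hr _, inv_mem (hl _)]
  induction w generalizing y B with
  | nil =>
    have h1 : (mk [] : FreeGroup α) = 1 := rfl
    rw [h1, _root_.map_one, mul_one]
    exact isReduced_cons_of_forall_mem hy isReduced_toWord (mul_mem (hR y) hB)
  | cons c w ih =>
    have hcw := mk_cons c w
    have hw' : IsReduced w := hw.infix ⟨[c], [], by simp⟩
    by_cases hc : c.1 ∈ C
    · have hfix : flank l r (mk [c]) = mk [c] := by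
        rw [flank_mk_singleton]
        simp [flankL, flankR, hlC _ hc, hrC _ hc]
      -- A fixed letter of `C` is absorbed into `B`, which collects everything since the last letter
      -- outside `C`.
      rw [hcw, _root_.map_mul, hfix, ← mul_assoc, mul_assoc (flankR l r y)]
      rw [hcw, ← mul_assoc] at h
      exact ih hw' y hy _ (mul_mem hB (mk_singleton_mem_supportedOn hc)) h
    · have h1 := ih hw' c hc 1 (one_mem _) (by rwa [one_mul, hw'.toWord_mk])
      set m := (flankR l r c * 1 * flank l r (mk w)).toWord with hm
      have hB' : flankR l r y * B * flankL l r c ∈ supportedOn C :=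
        mul_mem (mul_mem (hR y) hB) (hL c)
      have e : flankR l r y * B * flank l r (mk (c :: w)) =
          mk ((flankR l r y * B * flankL l r c).toWord ++ c :: m) := by
        rw [← mul_mk, mk_toWord, hcw, _root_.map_mul, flank_mk_singleton]
        rw [mk_cons c m, hm, mk_toWord]
        group
      rw [e, (isReduced_append_cons hc isReduced_toWord hB' h1).toWord_mk]
      -- The element now standing between `y` and `c` either separates them or is trivial; only the
      -- second case could let them cancel.
      cases hz : (flankR l r y * B * flankL l r c).toWord with
      | cons z v =>
        rw [← hz, ← List.cons_append]
        refine List.isChain_append.2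
          ⟨isReduced_cons_of_forall_mem hy isReduced_toWord hB', h1, ?_⟩
        intro a ha b hb e
        simp only [List.head?_cons, Option.mem_def, Option.some.injEq] at hb
        subst hb
        rw [hz, List.getLast?_cons_cons, ← hz] at ha
        exact absurd (hB' a (List.mem_of_getLast? ha)) (e ▸ hc)
      | nil =>
        rw [List.nil_append]
        refine isReduced_cons_cons.2 ⟨fun e1 => ?_, h1⟩
        by_contra e2
        have hone := toWord_eq_nil_iff.1 hz
        -- If `c` is the inverse letter of `y`, their facing factors are inverse to each other. So
        -- `B` is trivial, and `y` and `c` already cancelled in the original word.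
        have hLR : flankL l r c = (flankR l r y)⁻¹ := by
          obtain ⟨y1, y2⟩ := y
          obtain ⟨c1, c2⟩ := c
          simp only at e1 e2
          subst e1
          cases y2 <;> cases c2 <;> simp_all [flankL, flankR]
        have hB1 : B = 1 := by
          rw [hLR, mul_inv_eq_one] at hone
          exact mul_eq_left.1 hone
        rw [hB1, one_mul, hw.toWord_mk] at h
        exact e2 ((isReduced_cons_cons.1 h).1 e1)

/-- The reduced word of `g` or of `g⁻¹` runs through the letter `a` and then through `b`. -/
def Passes (a b : α) (g : FreeGroup α) : Prop :=
  [(a, true), (b, true)] <:+: g.toWord ∨ [(a, true), (b, true)] <:+: g⁻¹.toWord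

theorem passes_inv {a b : α} {g : FreeGroup α} : Passes a b g⁻¹ ↔ Passes a b g := by
  unfold Passes
  rw [inv_inv, or_comm]

/-- Cut `g` between `a` and `b` and read both halves outward from the cut: `isReduced_cons_flank`
keeps `a` and `b` in place on either side, so the only new material at the cut is `r a * l b`. -/
theorem exists_flank_eq {C : Set α} {l r : α → FreeGroup α}
    (hl : ∀ x, l x ∈ supportedOn C) (hr : ∀ x, r x ∈ supportedOn C)
    (hlC : ∀ x ∈ C, l x = 1) (hrC : ∀ x ∈ C, r x = 1) {a b : α} (ha : a ∉ C) (hb : b ∉ C)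
    {g : FreeGroup α} (h : [(a, true), (b, true)] <:+: g.toWord) :
    ∃ m₁ m₂, IsReduced ((a, false) :: m₁) ∧ IsReduced ((b, true) :: m₂) ∧
      flank l r g = (mk ((a, false) :: m₁))⁻¹ * (r a * l b) * mk ((b, true) :: m₂) := by
  obtain ⟨w₁, w₂, hw⟩ := h
  have hred : IsReduced g.toWord := isReduced_toWord
  have hinv : IsReduced (g⁻¹).toWord := isReduced_toWord
  rw [toWord_inv] at hinv
  have h1 : IsReduced ((a, false) :: invRev w₁) := by
    refine hinv.infix ⟨invRev w₂ ++ [(b, false)], [], ?_⟩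
    rw [← hw]
    simp [invRev]
  have h2 : IsReduced ((b, true) :: w₂) := by
    refine hred.infix ⟨w₁ ++ [(a, true)], [], ?_⟩
    rw [← hw]
    simp
  have h1' : IsReduced (invRev w₁) := h1.infix ⟨[(a, false)], [], by simp⟩
  have h2' : IsReduced w₂ := h2.infix ⟨[(b, true)], [], by simp⟩
  have k1 := isReduced_cons_flank hl hr hlC hrC _ h1' _ ha 1 (one_mem _)
    (by rwa [one_mul, h1'.toWord_mk])
  have k2 := isReduced_cons_flank hl hr hlC hrC _ h2' _ hb 1 (one_mem _)
    (by rwa [one_mul, h2'.toWord_mk])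
  refine ⟨_, _, k1, k2, ?_⟩
  have hg : g = (mk (invRev w₁))⁻¹ * of a * of b * mk w₂ := by
    rw [inv_mk, invRev_invRev, ← mk_toWord (x := g), ← hw, of, of, mul_mk, mul_mk, mul_mk]
    simp
  have hfa : (mk [(a, false)] : FreeGroup α) = (of a)⁻¹ := by simp [of, inv_mk, invRev]
  have htb : (mk [(b, true)] : FreeGroup α) = of b := rfl
  rw [mk_cons, mk_cons (b, true), mk_toWord, mk_toWord, hfa, htb, hg]
  simp only [_root_.map_mul, _root_.map_inv, flank_of, flankR, mul_inv_rev, inv_inv, mul_assoc,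
    mul_one, if_true, Bool.false_eq_true, if_false]

/-- If nothing is inserted between `a` and `b`, then `flank l r` preserves the passes
through `a` and `b`. -/
theorem Passes.flank {C : Set α} {l r : α → FreeGroup α}
    (hl : ∀ x, l x ∈ supportedOn C) (hr : ∀ x, r x ∈ supportedOn C)
    (hlC : ∀ x ∈ C, l x = 1) (hrC : ∀ x ∈ C, r x = 1) {a b : α} (ha : a ∉ C) (hb : b ∉ C)
    (hra : r a = 1) (hlb : l b = 1) {g : FreeGroup α} (h : Passes a b g) :
    Passes a b (flank l r g) := by
  have key : ∀ g : FreeGroup α, [(a, true), (b, true)] <:+: g.toWord →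
      [(a, true), (b, true)] <:+: (FreeGroup.flank l r g).toWord := by
    intro g hg
    obtain ⟨m₁, m₂, h1, h2, e⟩ := exists_flank_eq hl hr hlC hrC ha hb hg
    have h1' : IsReduced (invRev m₁ ++ [(a, true)]) := by
      have : IsReduced ((mk ((a, false) :: m₁))⁻¹).toWord := isReduced_toWord
      rw [toWord_inv, h1.toWord_mk, invRev_cons] at this
      simpa [invRev] using this
    have h3 : IsReduced (invRev m₁ ++ (a, true) :: (b, true) :: m₂) :=
      List.isChain_append_cons_cons.2 ⟨h1', fun _ => rfl, h2⟩
    have e' : FreeGroup.flank l r g = mk (invRev m₁ ++ (a, true) :: (b, true) :: m₂) := by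
      rw [e, hra, hlb, inv_mk, invRev_cons, mul_one, mul_one, mul_mk]
      simp [invRev]
    rw [e', h3.toWord_mk]
    exact ⟨invRev m₁, m₂, by simp⟩
  rcases h with h | h
  · exact Or.inl (key _ h)
  · exact Or.inr (by rw [← _root_.map_inv]; exact key _ h)

/-- A positive word `P` in letters of `C`, enclosed between letters outside of `C`, survives in
the reduced word. -/
theorem map_infix_toWord {C : Set α} {P : List α} (hP : ∀ x ∈ P, x ∈ C) (hne : P ≠ [])
    {a b : α × Bool} (ha : a.1 ∉ C) (hb : b.1 ∉ C) {m₁ m₂ : List (α × Bool)}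
    (h1 : IsReduced (a :: m₁)) (h2 : IsReduced (b :: m₂)) :
    (P.map fun x => (x, true)) <:+:
      ((mk (a :: m₁))⁻¹ * mk (P.map fun x => (x, true)) * mk (b :: m₂)).toWord := by
  have h1' : IsReduced (invRev (a :: m₁)) := by
    have : IsReduced ((mk (a :: m₁))⁻¹).toWord := isReduced_toWord
    rwa [toWord_inv, h1.toWord_mk] at this
  have hPC : ∀ z ∈ P.map (fun x => (x, true)), z.1 ∈ C := by
    intro z hz
    obtain ⟨x, hx, rfl⟩ := List.mem_map.1 hz
    exact hP x hx
  have h3 := isReduced_append_cons hb (isReduced_map_true P) hPC h2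
  have h4 : IsReduced (invRev (a :: m₁) ++ (P.map (fun x => (x, true)) ++ b :: m₂)) := by
    refine List.isChain_append.2 ⟨h1', h3, ?_⟩
    intro x hx y hy e
    obtain ⟨p, P, rfl⟩ := List.exists_cons_of_ne_nil hne
    simp only [List.map_cons, List.cons_append, List.head?_cons, Option.mem_def,
      Option.some.injEq] at hy
    rw [invRev_cons, invRev, invRev, List.map_singleton, List.reverse_singleton,
      List.getLast?_concat, Option.mem_def, Option.some.injEq] at hx
    subst hx hy
    simp only at e
    exact absurd (hP p (by simp)) (e ▸ ha)
  rw [inv_mk, mul_mk, mul_mk, List.append_assoc, h4.toWord_mk]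
  exact ⟨_, _, by rw [List.append_assoc]⟩

/-- If a power of a positive word is inserted between `a` and `b`, then a pass through `a` and `b`
creates a pass through any two letters which are consecutive in that power. -/
theorem Passes.flank_of_insert {C : Set α} {l r : α → FreeGroup α}
    (hl : ∀ x, l x ∈ supportedOn C) (hr : ∀ x, r x ∈ supportedOn C)
    (hlC : ∀ x ∈ C, l x = 1) (hrC : ∀ x ∈ C, r x = 1) {a b : α} (ha : a ∉ C) (hb : b ∉ C)
    {P : List α} (hP : ∀ x ∈ P, x ∈ C) {x y : α} (hxy : [x, y] <:+: P)
    (hins : r a * l b = mk (P.map fun x => (x, true)) ∨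
      r a * l b = (mk (P.map fun x => (x, true)))⁻¹)
    {g : FreeGroup α} (h : Passes a b g) : Passes x y (FreeGroup.flank l r g) := by
  have hne : P ≠ [] := by
    rintro rfl
    simp at hxy
  have hmap : [(x, true), (y, true)] <:+: P.map (fun x => (x, true)) := hxy.map fun x => (x, true)
  have key : ∀ g : FreeGroup α, [(a, true), (b, true)] <:+: g.toWord →
      Passes x y (FreeGroup.flank l r g) := by
    intro g hg
    obtain ⟨m₁, m₂, h1, h2, e⟩ := exists_flank_eq hl hr hlC hrC ha hb hg
    rcases hins with hins | hins
    · left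
      rw [e, hins]
      exact hmap.trans (map_infix_toWord hP hne ha hb h1 h2)
    · right
      rw [e, hins]
      simp only [mul_inv_rev, inv_inv, ← mul_assoc]
      exact hmap.trans (map_infix_toWord hP hne hb ha h2 h1)
  rcases h with h | h
  · exact key _ h
  · rw [← passes_inv, ← _root_.map_inv]
    exact key _ h

end Words

/-! ### Positive words -/

/-- The element of the free group given by a positive word. -/
def ofList {α : Type*} (l : List α) : FreeGroup α := mk (l.map fun x => (x, true))

theorem ofList_append {α : Type*} (l l' : List α) :
    ofList (l ++ l') = ofList l * ofList l' := by
  simp [ofList]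

theorem ofList_nil {α : Type*} : ofList ([] : List α) = 1 := rfl

theorem ofList_cons {α : Type*} (x : α) (l : List α) : ofList (x :: l) = of x * ofList l :=
  ofList_append [x] l

theorem ofList_flatten_replicate {α : Type*} (l : List α) (n : ℕ) :
    ofList (List.replicate n l).flatten = ofList l ^ n := by
  induction n with
  | zero => rfl
  | succ n ih => rw [List.replicate_succ, List.flatten_cons, ofList_append, ih, pow_succ']

theorem map_ofList_eq_self {α : Type*} {φ : FreeGroup α →* FreeGroup α} {l : List α}
    (h : ∀ x ∈ l, φ (of x) = of x) : φ (ofList l) = ofList l := by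
  induction l with
  | nil => exact _root_.map_one φ
  | cons x l ih =>
    rw [ofList_cons, _root_.map_mul, h x (by simp), ih fun y hy => h y (by simp [hy])]

theorem ofList_mem_supportedOn {α : Type*} [DecidableEq α] {C : Set α} {l : List α}
    (h : ∀ x ∈ l, x ∈ C) : ofList l ∈ supportedOn C := by
  induction l with
  | nil => exact one_mem _
  | cons x l ih =>
    rw [ofList_cons]
    exact mul_mem (of_mem_supportedOn (h x (by simp))) (ih fun y hy => h y (by simp [hy]))

theorem end_ext {α : Type*} {f g : Monoid.End (FreeGroup α)} (h : ∀ x, f (of x) = g (of x)) :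
    f = g :=
  ext_hom _ _ h

theorem end_mul_apply {G : Type*} [Monoid G] (f g : Monoid.End G) (x : G) : (f * g) x = f (g x) :=
  rfl

end FreeGroup

/-! ### Circles, arcs and loops -/

namespace ArtinTits

open FreeGroup hiding map_mul map_inv map_one

/-- The circles: `inl s` is the circle of the vertex `s`, and `inr s` is an auxiliary circle
that meets only the circle of `s`. On the circle `v`, the letters `(v, u, false)` and
`(v, u, true)` are the arcs that arrive at, and depart from, the point with label `u`. -/
abbrev Letter (S : Type*) : Type _ := (S ⊕ S) × S × Bool

/-- The label of the points at which a circle is crossed. -/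
def node {S : Type*} : S ⊕ S → S := Sum.elim id id

/-- The circle `v` crosses the circle of the vertex `s`. -/
def Crosses {S : Type*} (M : CoxeterMatrix S) (v : S ⊕ S) (s : S) : Prop :=
  Sum.elim (fun t => M t s = 3) (fun t => t = s) v

/-- The arcs of the circle of `s` through the `d` points that follow the point `t`. -/
def arcWord {S : Type*} (c : Equiv.Perm S) (s t : S) (d : ℕ) : List (Letter S) :=
  (List.range d).flatMap fun i =>
    [(Sum.inl s, (c ^ (i + 1)) t, false), (Sum.inl s, (c ^ (i + 1)) t, true)]

/-- The circle of `s`, read from the point `t`. -/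
def loopWord {S : Type*} [Fintype S] (c : Equiv.Perm S) (s t : S) : List (Letter S) :=
  (Sum.inl s, t, true) :: (arcWord c s t (Fintype.card S - 1) ++ [(Sum.inl s, t, false)])

/-- The circle of `s` as a loop at the point `t`. -/
def loop {S : Type*} [Fintype S] (c : Equiv.Perm S) (s t : S) : FreeGroup (Letter S) :=
  ofList (loopWord c s t)

theorem mem_arcWord {S : Type*} {c : Equiv.Perm S} {s t : S} {d : ℕ} {x : Letter S} :
    x ∈ arcWord c s t d → x.1 = Sum.inl s ∧ ∃ i < d, x.2.1 = (c ^ (i + 1)) t := by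
  simp only [arcWord, List.mem_flatMap, List.mem_range, List.mem_cons, List.not_mem_nil, or_false]
  rintro ⟨i, hi, rfl | rfl⟩ <;> exact ⟨rfl, i, hi, rfl⟩

theorem fst_of_mem_loopWord {S : Type*} [Fintype S] {c : Equiv.Perm S} {s t : S} {x : Letter S}
    (h : x ∈ loopWord c s t) : x.1 = Sum.inl s := by
  simp only [loopWord, List.mem_cons, List.mem_append, List.not_mem_nil, or_false] at h
  rcases h with rfl | h | rfl
  exacts [rfl, (mem_arcWord h).1, rfl]

theorem arcWord_add {S : Type*} (c : Equiv.Perm S) (s t : S) (a b : ℕ) :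
    arcWord c s t (a + b) = arcWord c s t a ++ arcWord c s ((c ^ a) t) b := by
  simp only [arcWord, List.range_add, List.flatMap_append, List.flatMap_map]
  congr 2
  ext1 i
  have : (c ^ (a + i + 1)) t = (c ^ (i + 1)) ((c ^ a) t) := by
    rw [← Equiv.Perm.mul_apply, ← pow_add]
    congr 2
    omega
  rw [this]

theorem arcWord_split {S : Type*} [Fintype S] {c : Equiv.Perm S} (s : S) {t u : S} {d n : ℕ}
    (hu : (c ^ d) t = u) (hd : 0 < d) (hdn : d < n) :
    arcWord c s t (n - 1) = arcWord c s t (d - 1) ++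
      (Sum.inl s, u, false) :: (Sum.inl s, u, true) :: arcWord c s u (n - d - 1) := by
  have e : n - 1 = d + (n - d - 1) := by omega
  have e' : d = (d - 1) + 1 := by omega
  rw [e, arcWord_add, hu]
  nth_rewrite 1 [e']
  rw [arcWord_add]
  have h1 : (c ^ (0 + 1)) ((c ^ (d - 1)) t) = u := by
    rw [← Equiv.Perm.mul_apply, ← pow_add, ← hu]
    congr 2
    omega
  simp [arcWord, List.range_one, ← h1]

/-- The points `t` and `u` cut the circle into two arcs, and its readings from `t` and from `u`
traverse them in opposite orders. -/
theorem exists_loopWord_eq {S : Type*} [Fintype S] {c : Equiv.Perm S}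
    (hc : c.IsCycleOn Set.univ) (s : S) {t u : S} (htu : t ≠ u) :
    ∃ p q : List (Letter S),
      loopWord c s t = (Sum.inl s, t, true) :: (p ++
        (Sum.inl s, u, false) :: (Sum.inl s, u, true) :: (q ++ [(Sum.inl s, t, false)])) ∧
      loopWord c s u = (Sum.inl s, u, true) :: (q ++
        (Sum.inl s, t, false) :: (Sum.inl s, t, true) :: (p ++ [(Sum.inl s, u, false)])) ∧
      (∀ x ∈ p, x.2.1 ≠ t ∧ x.2.1 ≠ u) ∧ ∀ x ∈ q, x.2.1 ≠ t ∧ x.2.1 ≠ u := by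
  have hc' : c.IsCycleOn (Finset.univ : Finset S) := by simpa using hc
  obtain ⟨d, hdn, hd⟩ := hc'.exists_pow_eq (Finset.mem_univ t) (Finset.mem_univ u)
  rw [Finset.card_univ] at hdn
  have hd0 : 0 < d := Nat.pos_of_ne_zero fun h => htu (by simpa [h] using hd)
  have hper : ∀ v : S, (c ^ Fintype.card S) v = v := fun v =>
    (hc'.pow_apply_eq (Finset.mem_univ v)).2 (by simp)
  -- Fewer than `Fintype.card S` further steps along the cycle never return to the same point.
  have hne : ∀ (v : S) (i j : ℕ), i < j → j < Fintype.card S + i → (c ^ i) v ≠ (c ^ j) v := by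
    intro v i j hij hj h
    have := (hc'.pow_apply_eq_pow_apply (Finset.mem_univ v)).1 h
    rw [Finset.card_univ] at this
    have h2 := (Nat.modEq_iff_dvd' hij.le).1 this
    have h3 := Nat.le_of_dvd (by omega) h2
    omega
  have hd' : (c ^ (Fintype.card S - d)) u = t := by
    rw [← hd, ← Equiv.Perm.mul_apply, ← pow_add, Nat.sub_add_cancel hdn.le, hper]
  refine ⟨arcWord c s t (d - 1), arcWord c s u (Fintype.card S - d - 1), ?_, ?_, ?_, ?_⟩
  · rw [loopWord, arcWord_split s hd hd0 hdn]
    simp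
  · rw [loopWord, arcWord_split s hd' (by omega) (by omega)]
    have : Fintype.card S - (Fintype.card S - d) - 1 = d - 1 := by omega
    rw [this]
    simp
  · intro x hx
    obtain ⟨-, i, hi, hxi⟩ := mem_arcWord hx
    rw [hxi, ← hd]
    exact ⟨(hne t 0 (i + 1) (by omega) (by omega)).symm, hne t (i + 1) d (by omega) (by omega)⟩
  · intro x hx
    obtain ⟨-, i, hi, hxi⟩ := mem_arcWord hx
    rw [hxi]
    refine ⟨?_, (hne u 0 (i + 1) (by omega) (by omega)).symm⟩
    conv_rhs => rw [← hd']
    exact hne u (i + 1) _ (by omega) (by omega)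

theorem not_crosses_self (M : CoxeterMatrix S) (s : S) : ¬ Crosses M (Sum.inl s) s := by
  simp [Crosses]

theorem not_crosses_of_eq_two {M : CoxeterMatrix S} {s t : S} (h : M t s = 2) :
    ¬ Crosses M (Sum.inl t) s := by
  simp [Crosses, h]

/-! ### Twists along circles: powers and commutation -/

section Twist

variable {S : Type*} [Fintype S] [LinearOrder S]

open Classical in
/-- The left factor which the `k`-th power of the twist along the circle of `s` attaches to a
letter. -/
noncomputable def twistL (M : CoxeterMatrix S) (c : Equiv.Perm S) (s : S) (k : ℤ) (x : Letter S) :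
    FreeGroup (Letter S) :=
  if x.2.1 = s ∧ Crosses M x.1 s ∧ s ≤ node x.1 ∧ x.2.2 = true then loop c s (node x.1) ^ k else 1

open Classical in
/-- The right factor which the `k`-th power of the twist along the circle of `s` attaches to a
letter. -/
noncomputable def twistR (M : CoxeterMatrix S) (c : Equiv.Perm S) (s : S) (k : ℤ) (x : Letter S) :
    FreeGroup (Letter S) :=
  if x.2.1 = s ∧ Crosses M x.1 s ∧ ¬ s ≤ node x.1 ∧ x.2.2 = false then
    (loop c s (node x.1) ^ k)⁻¹ else 1

/-- The `k`-th power of the twist along the circle of `s`. -/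
noncomputable def twist (M : CoxeterMatrix S) (c : Equiv.Perm S) (s : S) (k : ℤ) :
    Monoid.End (FreeGroup (Letter S)) :=
  flank (twistL M c s k) (twistR M c s k)

/-- The letters of the circle of `s`. -/
def circleLetters (s : S) : Set (Letter S) := {x | x.1 = Sum.inl s}

theorem loop_mem_supportedOn (c : Equiv.Perm S) (s t : S) :
    loop c s t ∈ supportedOn (circleLetters s) :=
  ofList_mem_supportedOn fun _ hx => fst_of_mem_loopWord hx

theorem twistL_mem_supportedOn (M : CoxeterMatrix S) (c : Equiv.Perm S) (s : S) (k : ℤ)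
    (x : Letter S) : twistL M c s k x ∈ supportedOn (circleLetters s) := by
  unfold twistL
  split_ifs
  exacts [zpow_mem (loop_mem_supportedOn _ _ _) _, one_mem _]

theorem twistR_mem_supportedOn (M : CoxeterMatrix S) (c : Equiv.Perm S) (s : S) (k : ℤ)
    (x : Letter S) : twistR M c s k x ∈ supportedOn (circleLetters s) := by
  unfold twistR
  split_ifs
  exacts [inv_mem (zpow_mem (loop_mem_supportedOn _ _ _) _), one_mem _]

theorem twistL_of_not_crosses {M : CoxeterMatrix S} {c : Equiv.Perm S} {s : S} {k : ℤ}
    {x : Letter S} (h : ¬ Crosses M x.1 s) : twistL M c s k x = 1 :=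
  if_neg fun h' => h h'.2.1

theorem twistR_of_not_crosses {M : CoxeterMatrix S} {c : Equiv.Perm S} {s : S} {k : ℤ}
    {x : Letter S} (h : ¬ Crosses M x.1 s) : twistR M c s k x = 1 :=
  if_neg fun h' => h h'.2.1

theorem twistL_of_ne {M : CoxeterMatrix S} {c : Equiv.Perm S} {s : S} {k : ℤ}
    {x : Letter S} (h : x.2.1 ≠ s) : twistL M c s k x = 1 :=
  if_neg fun h' => h h'.1

theorem twistR_of_ne {M : CoxeterMatrix S} {c : Equiv.Perm S} {s : S} {k : ℤ}
    {x : Letter S} (h : x.2.1 ≠ s) : twistR M c s k x = 1 :=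
  if_neg fun h' => h h'.1

theorem twist_of (M : CoxeterMatrix S) (c : Equiv.Perm S) (s : S) (k : ℤ) (x : Letter S) :
    twist M c s k (of x) = twistL M c s k x * of x * twistR M c s k x :=
  flank_of _ _ _

theorem twist_of_eq_self {M : CoxeterMatrix S} {c : Equiv.Perm S} {s : S} {k : ℤ}
    {x : Letter S} (h : ¬ (x.2.1 = s ∧ Crosses M x.1 s)) : twist M c s k (of x) = of x := by
  have hl : twistL M c s k x = 1 := if_neg fun h' => h ⟨h'.1, h'.2.1⟩
  have hr : twistR M c s k x = 1 := if_neg fun h' => h ⟨h'.1, h'.2.1⟩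
  rw [twist_of, hl, hr, one_mul, mul_one]

theorem twist_loop_of_not_crosses {M : CoxeterMatrix S} {c : Equiv.Perm S} {s t u : S} {k : ℤ}
    (h : ¬ Crosses M (Sum.inl t) s) : twist M c s k (loop c t u) = loop c t u :=
  map_ofList_eq_self fun _ hx => twist_of_eq_self fun h' => h (fst_of_mem_loopWord hx ▸ h'.2)

theorem twist_twistL_of_not_crosses {M : CoxeterMatrix S} {c : Equiv.Perm S} {s t : S} {k j : ℤ}
    (h : ¬ Crosses M (Sum.inl t) s) (x : Letter S) :
    twist M c s k (twistL M c t j x) = twistL M c t j x := by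
  unfold twistL
  split_ifs
  · rw [map_zpow, twist_loop_of_not_crosses h]
  · rw [map_one]

theorem twist_twistR_of_not_crosses {M : CoxeterMatrix S} {c : Equiv.Perm S} {s t : S} {k j : ℤ}
    (h : ¬ Crosses M (Sum.inl t) s) (x : Letter S) :
    twist M c s k (twistR M c t j x) = twistR M c t j x := by
  unfold twistR
  split_ifs
  · rw [map_inv, map_zpow, twist_loop_of_not_crosses h]
  · rw [map_one]

theorem twist_mul_twist (M : CoxeterMatrix S) (c : Equiv.Perm S) (s : S) (k j : ℤ) :
    twist M c s k * twist M c s j = twist M c s (k + j) := by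
  refine end_ext fun x => ?_
  rw [end_mul_apply, twist_of, map_mul, map_mul,
    twist_twistL_of_not_crosses (not_crosses_self M s),
    twist_twistR_of_not_crosses (not_crosses_self M s), twist_of, twist_of]
  unfold twistL twistR
  split_ifs <;> simp [zpow_add, mul_assoc]
  · simp_all
  · rw [← mul_assoc, ← mul_assoc, ← zpow_add, ← zpow_add, add_comm]
  · rw [← zpow_neg, ← zpow_neg, ← zpow_add, ← zpow_add, add_comm]

theorem twist_zero (M : CoxeterMatrix S) (c : Equiv.Perm S) (s : S) : twist M c s 0 = 1 := by
  refine end_ext fun x => ?_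
  rw [twist_of]
  unfold twistL twistR
  simp

theorem twist_commute {M : CoxeterMatrix S} {s t : S} (h : M s t = 2) (c : Equiv.Perm S)
    (k j : ℤ) : Commute (twist M c s k) (twist M c t j) := by
  have h' : M t s = 2 := by rw [M.symmetric, h]
  have hst : s ≠ t := by
    rintro rfl
    simp at h
  refine end_ext fun x => ?_
  rw [end_mul_apply, end_mul_apply, twist_of, twist_of M c s,
    map_mul, map_mul, map_mul, map_mul,
    twist_twistL_of_not_crosses (not_crosses_of_eq_two h),
    twist_twistR_of_not_crosses (not_crosses_of_eq_two h),
    twist_twistL_of_not_crosses (not_crosses_of_eq_two h'),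
    twist_twistR_of_not_crosses (not_crosses_of_eq_two h'), twist_of, twist_of]
  by_cases hx : x.2.1 = s
  · have : x.2.1 ≠ t := fun e => hst (hx.symm.trans e)
    rw [twistL_of_ne this, twistR_of_ne this]
    simp
  · rw [twistL_of_ne hx, twistR_of_ne hx]
    simp

end Twist

/-! ### The braid relation, the action, and its effect on passes -/

theorem node_ne_of_crosses {S : Type*} {M : CoxeterMatrix S} {s t : S} (hst : s ≠ t)
    {v : S ⊕ S} (hv : Crosses M v s) (h : v ≠ Sum.inl t) : t ≠ node v := by
  rintro rfl
  cases v with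
  | inl u => exact h rfl
  | inr u => exact hst hv.symm

/-- Covers letters that cross only one of the two circles: the braid relation at `x` reduces to an
identity for the single loop `l` inserted by `τ`. -/
theorem braid_apply_of_flank {G : Type*} [Group G] {τ υ : Monoid.End G} {x l L R : G}
    (hx : υ x = x) (hτ : τ x = L * x * R) (hL : L = 1 ∨ L = l) (hR : R = 1 ∨ R = l⁻¹)
    (hl : τ (υ l) * l = υ l) : τ (υ (τ x)) = υ (τ (υ x)) := by
  have h1 : τ (υ L) * L = υ L := by
    rcases hL with rfl | rfl
    · simp
    · exact hl
  have h2 : R * τ (υ R) = υ R := by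
    rcases hR with rfl | rfl
    · simp
    · rw [map_inv, map_inv, ← mul_inv_rev, hl]
  rw [hx, hτ, map_mul, map_mul, map_mul, map_mul, hx, hτ]
  conv_rhs => rw [← h1, ← h2]
  simp only [mul_assoc]

/-- Points other than the base point are passed within one turn; the base point `t` is passed only
at the junction of two turns, whence `2 ≤ n`. -/
theorem infix_flatten_replicate_loopWord {S : Type*} [Fintype S] {c : Equiv.Perm S}
    (hc : c.IsCycleOn Set.univ) (s t u : S) {n : ℕ} (hn : 2 ≤ n) :
    [(Sum.inl s, u, false), (Sum.inl s, u, true)] <:+: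
      (List.replicate n (loopWord c s t)).flatten := by
  obtain ⟨n, rfl⟩ := Nat.exists_eq_add_of_le' hn
  rw [List.replicate_succ, List.replicate_succ, List.flatten_cons, List.flatten_cons]
  rcases eq_or_ne t u with rfl | htu
  · refine ⟨(Sum.inl s, t, true) :: arcWord c s t (Fintype.card S - 1),
      (arcWord c s t (Fintype.card S - 1) ++ [(Sum.inl s, t, false)]) ++
        (List.replicate n (loopWord c s t)).flatten, ?_⟩
    simp [loopWord]
  · obtain ⟨p, q, h, -⟩ := exists_loopWord_eq hc s htu
    refine List.IsInfix.trans ⟨(Sum.inl s, t, true) :: p, q ++ [(Sum.inl s, t, false)], ?_⟩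
      (List.prefix_append (loopWord c s t) _).isInfix
    simp [h]

section Action

variable {S : Type*} [Fintype S] [LinearOrder S]

theorem twistL_one_eq (M : CoxeterMatrix S) (c : Equiv.Perm S) (s : S) (x : Letter S) :
    twistL M c s 1 x = 1 ∨ twistL M c s 1 x = loop c s (node x.1) := by
  unfold twistL
  split_ifs <;> simp

theorem twistR_one_eq (M : CoxeterMatrix S) (c : Equiv.Perm S) (s : S) (x : Letter S) :
    twistR M c s 1 x = 1 ∨ twistR M c s 1 x = (loop c s (node x.1))⁻¹ := by
  unfold twistR
  split_ifs <;> simp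

theorem twist_of_inl_true {M : CoxeterMatrix S} (c : Equiv.Perm S) {s t : S} (h : M t s = 3) :
    twist M c s 1 (of (Sum.inl t, s, true)) =
      if s ≤ t then loop c s t * of (Sum.inl t, s, true) else of (Sum.inl t, s, true) := by
  rw [twist_of, twistL, twistR]
  split_ifs <;> simp_all [node, Crosses]

theorem twist_of_inl_false {M : CoxeterMatrix S} (c : Equiv.Perm S) {s t : S} (h : M t s = 3) :
    twist M c s 1 (of (Sum.inl t, s, false)) =
      if s ≤ t then of (Sum.inl t, s, false) else
        of (Sum.inl t, s, false) * (loop c s t)⁻¹ := by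
  rw [twist_of, twistL, twistR]
  split_ifs <;> simp_all [node, Crosses]

theorem exists_loop_eq {M : CoxeterMatrix S} {c : Equiv.Perm S} (hc : c.IsCycleOn Set.univ)
    (s : S) {t u : S} (htu : t ≠ u) :
    ∃ p q : FreeGroup (Letter S),
      loop c s t = (of (Sum.inl s, t, true) * p * of (Sum.inl s, u, false)) *
        (of (Sum.inl s, u, true) * q * of (Sum.inl s, t, false)) ∧
      loop c s u = (of (Sum.inl s, u, true) * q * of (Sum.inl s, t, false)) *
        (of (Sum.inl s, t, true) * p * of (Sum.inl s, u, false)) ∧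
      (∀ r, r = s ∨ r = t → twist M c r 1 p = p ∧ twist M c r 1 q = q) ∧
      ∀ w b, twist M c s 1 (of (Sum.inl s, w, b)) = of (Sum.inl s, w, b) := by
  obtain ⟨p, q, h1, h2, hp, hq⟩ := exists_loopWord_eq hc s htu
  refine ⟨ofList p, ofList q, ?_, ?_, ?_, ?_⟩
  · simp only [loop, h1, ofList_cons, ofList_append, ofList_nil, mul_one, mul_assoc]
  · simp only [loop, h2, ofList_cons, ofList_append, ofList_nil, mul_one, mul_assoc]
  · rintro r (rfl | rfl)
    · refine ⟨map_ofList_eq_self fun x hx => twist_of_eq_self fun h => ?_,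
        map_ofList_eq_self fun x hx => twist_of_eq_self fun h => ?_⟩
      all_goals
        have hmem : x ∈ loopWord c r t := by
          rw [h1]
          simp [hx]
        exact not_crosses_self M r (fst_of_mem_loopWord hmem ▸ h.2)
    · exact ⟨map_ofList_eq_self fun x hx => twist_of_eq_self fun h => (hp x hx).1 h.1,
        map_ofList_eq_self fun x hx => twist_of_eq_self fun h => (hq x hx).1 h.1⟩
  · exact fun w b => twist_of_eq_self fun h => not_crosses_self M s h.2

/-- Here `g` and `h` are the arcs from `t` to `u` and back. As `s < t`, the twist along `t` acts
only where the circle of `s` arrives at `t`, which is the end of `h`. -/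
theorem exists_twist_loop_of_lt {M : CoxeterMatrix S} {c : Equiv.Perm S}
    (hc : c.IsCycleOn Set.univ) {s t : S} (hst : s < t) (hM : M s t = 3) {u : S} (hu : t ≠ u) :
    ∃ g h, loop c s t = g * h ∧ loop c s u = h * g ∧ twist M c t 1 g = g ∧
      twist M c t 1 h = h * (loop c t s)⁻¹ ∧ twist M c s 1 g = g ∧ twist M c s 1 h = h := by
  obtain ⟨p, q, h1, h2, hpq, hs⟩ := exists_loop_eq (M := M) hc s hu
  have h3 : ∀ b, twist M c t 1 (of (Sum.inl s, u, b)) = of (Sum.inl s, u, b) :=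
    fun b => twist_of_eq_self fun h => hu h.1.symm
  have ht := hpq t (Or.inr rfl)
  have hs' := hpq s (Or.inl rfl)
  refine ⟨_, _, h1, h2, ?_, ?_, ?_, ?_⟩
  · rw [map_mul, map_mul, ht.1, h3, twist_of_inl_true c hM, if_neg hst.not_ge]
  · rw [map_mul, map_mul, ht.2, h3, twist_of_inl_false c hM, if_neg hst.not_ge]
    simp only [mul_assoc]
  · rw [map_mul, map_mul, hs, hs, hs'.1]
  · rw [map_mul, map_mul, hs, hs, hs'.2]

/-- The opposite sign at the same crossing: the twist along `s` acts where the circle of `t` departs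
from `s`, which is the start of `g`. -/
theorem exists_twist_loop_of_gt {M : CoxeterMatrix S} {c : Equiv.Perm S}
    (hc : c.IsCycleOn Set.univ) {s t : S} (hst : s < t) (hM : M t s = 3) {u : S} (hu : s ≠ u) :
    ∃ g h, loop c t s = g * h ∧ loop c t u = h * g ∧ twist M c s 1 g = loop c s t * g ∧
      twist M c s 1 h = h ∧ twist M c t 1 g = g ∧ twist M c t 1 h = h := by
  obtain ⟨p, q, h1, h2, hpq, ht⟩ := exists_loop_eq (M := M) hc t hu
  have h3 : ∀ b, twist M c s 1 (of (Sum.inl t, u, b)) = of (Sum.inl t, u, b) :=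
    fun b => twist_of_eq_self fun h => hu h.1.symm
  have hs := hpq s (Or.inr rfl)
  have ht' := hpq t (Or.inl rfl)
  refine ⟨_, _, h1, h2, ?_, ?_, ?_, ?_⟩
  · rw [map_mul, map_mul, hs.1, h3, twist_of_inl_true c hM, if_pos hst.le]
    simp only [mul_assoc]
  · rw [map_mul, map_mul, hs.2, h3, twist_of_inl_false c hM, if_pos hst.le]
  · rw [map_mul, map_mul, ht, ht, ht'.1]
  · rw [map_mul, map_mul, ht, ht, ht'.2]

/-- With `a = loop c s t` and `b = loop c t s` based at the crossing, the twists send `a` to `a *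
b⁻¹` and `b` to `a * b`. Letters of the two circles at their crossing are computed directly. Any
other affected letter reads its loop from a different point, so that loop is cut there and at the
crossing. -/
theorem twist_braid_of_lt {M : CoxeterMatrix S} {c : Equiv.Perm S}
    (hc : c.IsCycleOn Set.univ) {s t : S} (hst : s < t) (hM : M s t = 3) :
    twist M c s 1 * (twist M c t 1 * twist M c s 1) =
      twist M c t 1 * (twist M c s 1 * twist M c t 1) := by
  have hM' : M t s = 3 := by rw [M.symmetric, hM]
  have hss : ∀ u, twist M c s 1 (loop c s u) = loop c s u :=
    fun u => twist_loop_of_not_crosses (not_crosses_self M s)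
  have htt : ∀ u, twist M c t 1 (loop c t u) = loop c t u :=
    fun u => twist_loop_of_not_crosses (not_crosses_self M t)
  have hta : twist M c t 1 (loop c s t) = loop c s t * (loop c t s)⁻¹ := by
    obtain ⟨g, h, h1, -, hg, hh, -, -⟩ := exists_twist_loop_of_lt hc hst hM hst.ne'
    rw [h1, map_mul, hg, hh, mul_assoc]
  have hsb : twist M c s 1 (loop c t s) = loop c s t * loop c t s := by
    obtain ⟨g, h, h1, -, hg, hh, -, -⟩ := exists_twist_loop_of_gt hc hst hM' hst.ne
    rw [h1, map_mul, hg, hh, mul_assoc]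
  refine end_ext fun x => ?_
  simp only [end_mul_apply]
  by_cases hxs : x.2.1 = s ∧ Crosses M x.1 s
  · have hfix : twist M c t 1 (of x) = of x :=
      twist_of_eq_self fun h => hst.ne (hxs.1.symm.trans h.1)
    by_cases hxt : x.1 = Sum.inl t
    · obtain ⟨v, u, b⟩ := x
      obtain ⟨rfl, -⟩ := hxs
      simp only at hxt
      subst hxt
      cases b
      · rw [twist_of_inl_false c hM', if_pos hst.le, hfix, twist_of_inl_false c hM',
          if_pos hst.le, hfix]
      · rw [twist_of_inl_true c hM', if_pos hst.le, map_mul, hfix, hta, map_mul,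
          twist_of_inl_true c hM', if_pos hst.le, map_mul, map_inv, hsb, hss,
          map_mul, hta, hfix]
        group
    · obtain ⟨g, h, h1, h2, htg, hth, hsg, hsh⟩ :=
        exists_twist_loop_of_lt hc hst hM (node_ne_of_crosses hst.ne hxs.2 hxt)
      refine braid_apply_of_flank hfix (twist_of M c s 1 x) (twistL_one_eq M c s x)
        (twistR_one_eq M c s x) ?_
      rw [h2, map_mul, htg, hth, map_mul, map_mul, map_inv, hsg, hsh, hsb, h1]
      group
  · have hfix : twist M c s 1 (of x) = of x := twist_of_eq_self hxs
    by_cases hxt : x.2.1 = t ∧ Crosses M x.1 t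
    · by_cases hxs' : x.1 = Sum.inl s
      · obtain ⟨v, u, b⟩ := x
        obtain ⟨rfl, -⟩ := hxt
        simp only at hxs'
        subst hxs'
        cases b
        · rw [hfix, twist_of_inl_false c hM, if_neg hst.not_ge, map_mul, hfix, map_inv, hsb,
            map_mul, twist_of_inl_false c hM, if_neg hst.not_ge, map_inv, map_mul, hta, htt]
          group
        · rw [hfix, twist_of_inl_true c hM, if_neg hst.not_ge, hfix, twist_of_inl_true c hM,
            if_neg hst.not_ge]
      · obtain ⟨g, h, h1, h2, hsg, hsh, htg, hth⟩ :=
          exists_twist_loop_of_gt hc hst hM' (node_ne_of_crosses hst.ne' hxt.2 hxs')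
        refine (braid_apply_of_flank hfix (twist_of M c t 1 x) (twistL_one_eq M c t x)
          (twistR_one_eq M c t x) ?_).symm
        rw [h2, map_mul, hsg, hsh, map_mul, map_mul, htg, hth, hta, h1]
        group
    · have hfix' : twist M c t 1 (of x) = of x := twist_of_eq_self hxt
      simp only [hfix, hfix']

theorem twist_braid {M : CoxeterMatrix S} {c : Equiv.Perm S}
    (hc : c.IsCycleOn Set.univ) {s t : S} (hM : M s t = 3) :
    twist M c s 1 * (twist M c t 1 * twist M c s 1) =
      twist M c t 1 * (twist M c s 1 * twist M c t 1) := by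
  rcases lt_trichotomy s t with h | rfl | h
  · exact twist_braid_of_lt hc h hM
  · rfl
  · exact (twist_braid_of_lt hc h (by rw [M.symmetric, hM])).symm

/-- The powers of the twist along the circle of `s`, as invertible endomorphisms. -/
noncomputable def twistHom (M : CoxeterMatrix S) (c : Equiv.Perm S) (s : S) :
    Multiplicative ℤ →* (Monoid.End (FreeGroup (Letter S)))ˣ :=
  MonoidHom.toHomUnits
    { toFun := fun k => twist M c s k.toAdd
      map_one' := twist_zero M c s
      map_mul' := fun k j => (twist_mul_twist M c s k.toAdd j.toAdd).symm }

theorem coe_twistHom (M : CoxeterMatrix S) (c : Equiv.Perm S) (s : S) (k : ℤ) :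
    (twistHom M c s (Multiplicative.ofAdd k) : Monoid.End (FreeGroup (Letter S))) =
      twist M c s k := rfl

/-- The action of a small type Artin group by twists along circles. -/
noncomputable def artinAction {M : CoxeterMatrix S} (hM : IsSmallType M) {c : Equiv.Perm S}
    (hc : c.IsCycleOn Set.univ) :
    ArtinGroup M →* (Monoid.End (FreeGroup (Letter S)))ˣ :=
  PresentedGroup.toGroup (f := fun s => twistHom M c s (Multiplicative.ofAdd 1)) (by
    rintro r ⟨s, t, -, rfl⟩
    -- The relators also include the diagonal pairs, where both sides coincide.
    rcases eq_or_ne s t with rfl | hst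
    · simp
    rw [map_mul, map_inv, mul_inv_eq_one]
    rcases hM s t hst with h | h
    · simp only [altProd, h, even_two, if_true, Nat.div_self two_pos, pow_one,
        map_mul, FreeGroup.lift_apply_of]
      exact Units.ext (twist_commute h c 1 1).eq
    · simp only [altProd, h, map_mul, FreeGroup.lift_apply_of,
        if_neg (show ¬ Even 3 by decide), Nat.add_one_sub_one, Nat.div_self two_pos, pow_one,
        mul_assoc]
      exact Units.ext (twist_braid hc h))

theorem coe_artinAction_sigma_zpow {M : CoxeterMatrix S} (hM : IsSmallType M) {c : Equiv.Perm S}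
    (hc : c.IsCycleOn Set.univ) (s : S) (k : ℤ) :
    (artinAction hM hc (sigma M s ^ k) : Monoid.End (FreeGroup (Letter S))) = twist M c s k := by
  have h : artinAction hM hc (sigma M s) = twistHom M c s (Multiplicative.ofAdd 1) :=
    PresentedGroup.toGroup.of _
  rw [map_zpow, h, ← map_zpow, ← ofAdd_zsmul, smul_eq_mul, mul_one, coe_twistHom]

/-- Twists along other circles preserve the passes through the point `u` of the circle `v`. -/
theorem passes_twist {M : CoxeterMatrix S} {c : Equiv.Perm S} {s u : S} {v : S ⊕ S} (k : ℤ)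
    (hv : v ≠ Sum.inl s) (hu : u ≠ s) {g : FreeGroup (Letter S)}
    (h : Passes (v, u, false) (v, u, true) g) :
    Passes (v, u, false) (v, u, true) (twist M c s k g) :=
  h.flank (twistL_mem_supportedOn M c s k) (twistR_mem_supportedOn M c s k)
    (fun x hx => twistL_of_not_crosses (by rw [hx]; exact not_crosses_self M s))
    (fun x hx => twistR_of_not_crosses (by rw [hx]; exact not_crosses_self M s))
    hv hv (twistR_of_ne hu) (twistL_of_ne hu)

/-- A pass through the intersection with the circle of `s` is turned by higher powers of the twist
along this circle into passes through all points of the circle. -/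
theorem passes_twist_of_crosses {M : CoxeterMatrix S} {c : Equiv.Perm S}
    (hc : c.IsCycleOn Set.univ) {s : S} {v : S ⊕ S} {k : ℤ} (hk : 2 ≤ k.natAbs)
    (hv : Crosses M v s) (u : S) {g : FreeGroup (Letter S)}
    (h : Passes (v, s, false) (v, s, true) g) :
    Passes (Sum.inl s, u, false) (Sum.inl s, u, true) (twist M c s k g) := by
  have hvs : v ≠ Sum.inl s := by
    rintro rfl
    exact not_crosses_self M s hv
  refine h.flank_of_insert (P := (List.replicate k.natAbs (loopWord c s (node v))).flatten)
    (twistL_mem_supportedOn M c s k) (twistR_mem_supportedOn M c s k)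
    (fun x hx => twistL_of_not_crosses (by rw [hx]; exact not_crosses_self M s))
    (fun x hx => twistR_of_not_crosses (by rw [hx]; exact not_crosses_self M s))
    hvs hvs ?_ (infix_flatten_replicate_loopWord hc s _ u hk) ?_
  · intro x hx
    simp only [List.mem_flatten, List.mem_replicate] at hx
    obtain ⟨l, ⟨-, rfl⟩, hx⟩ := hx
    exact fst_of_mem_loopWord hx
  · have e : mk ((List.replicate k.natAbs (loopWord c s (node v))).flatten.map
        fun x => (x, true)) = loop c s (node v) ^ k.natAbs := ofList_flatten_replicate _ _
    rw [e, ← zpow_natCast]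
    unfold twistL twistR
    rcases Int.natAbs_eq k with hk' | hk' <;> by_cases hle : s ≤ node v
    all_goals
      rw [hk']
      simp [hv, hle]

end Action

/-! ### `M`-reduced expressions -/

section Expressions

variable {S : Type*} {M : CoxeterMatrix S}

theorem ElemOp.cons (x : S × {p : ℤ // p ≠ 0}) {W W' : Expression S} (h : ElemOp M W W') :
    ElemOp M (x :: W) (x :: W') := by
  cases h with
  | merge U V s p q h => exact ElemOp.merge (x :: U) V s p q h
  | cancel U V s p q h => exact ElemOp.cancel (x :: U) V s p q h
  | swap U V s t p q h => exact ElemOp.swap (x :: U) V s t p q h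

theorem ElemOp.eval_eq {W W' : Expression S} (h : ElemOp M W W') :
    Expression.eval M W = Expression.eval M W' := by
  cases h with
  | merge U V s p q h => simp [Expression.eval, zpow_add, mul_assoc]
  | cancel U V s p q h =>
    have : genT M s ^ (p : ℤ) * genT M s ^ (q : ℤ) = 1 := by rw [← zpow_add, h, zpow_zero]
    simp [Expression.eval, ← mul_assoc _ _ (List.prod _), this]
  | swap U V s t p q h =>
    have key : PresentedGroup.mk (commRels M)
        ((FreeGroup.of s * FreeGroup.of t) * (FreeGroup.of t * FreeGroup.of s)⁻¹) = 1 :=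
      PresentedGroup.one_of_mem ⟨s, t, h, rfl⟩
    rw [map_mul, map_inv, mul_inv_eq_one, map_mul, map_mul] at key
    have hc : Commute (genT M s) (genT M t) := key
    have := (hc.zpow_zpow (p : ℤ) (q : ℤ)).eq
    simp [Expression.eval, ← mul_assoc _ _ (List.prod _), this]

theorem Expression.IsMReduced.of_cons {x : S × {p : ℤ // p ≠ 0}} {W : Expression S}
    (h : Expression.IsMReduced M (x :: W)) : Expression.IsMReduced M W := by
  intro W' hW
  have := h (x :: W') (hW.lift (x :: ·) fun _ _ => ElemOp.cons x)
  simpa using this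

theorem Expression.exists_isMReduced (M : CoxeterMatrix S) (W : Expression S) :
    ∃ W', Expression.IsMReduced M W' ∧ Expression.eval M W' = Expression.eval M W := by
  induction hn : W.length using Nat.strong_induction_on generalizing W with
  | _ n ih =>
    by_cases h : Expression.IsMReduced M W
    · exact ⟨W, h, rfl⟩
    · simp only [Expression.IsMReduced, not_forall, not_le] at h
      obtain ⟨W₁, h₁, hlt⟩ := h
      obtain ⟨W', h', e⟩ := ih _ (hn ▸ hlt) W₁ rfl
      refine ⟨W', h', e.trans ?_⟩
      clear hlt e hn ih
      induction h₁ with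
      | refl => rfl
      | tail _ hop ih => rw [← hop.eval_eq, ih]

theorem Expression.eval_surjective (M : CoxeterMatrix S) :
    Function.Surjective (Expression.eval M) := by
  intro w
  obtain ⟨g, rfl⟩ := PresentedGroup.mk_surjective _ w
  induction g using FreeGroup.induction_on with
  | C1 => exact ⟨[], rfl⟩
  | of s =>
    exact ⟨[(s, ⟨1, one_ne_zero⟩)], by simp [Expression.eval]; rfl⟩
  | inv_of s _ =>
    exact ⟨[(s, ⟨-1, by decide⟩)], by simp [Expression.eval]; rfl⟩
  | mul g h hg hh =>
    obtain ⟨W, hW⟩ := hg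
    obtain ⟨W', hW'⟩ := hh
    exact ⟨W ++ W', by rw [map_mul, ← hW, ← hW']; simp [Expression.eval]⟩

/-- A syllable can be moved to the right across syllables that commute with it. -/
theorem reflTransGen_swap (s : S) (p : {p : ℤ // p ≠ 0}) (A V : Expression S)
    (hA : ∀ x ∈ A, M s x.1 = 2) :
    Relation.ReflTransGen (ElemOp M) ((s, p) :: (A ++ V)) (A ++ (s, p) :: V) := by
  induction A with
  | nil => exact .refl
  | cons x A ih =>
    refine .head (ElemOp.swap [] (A ++ V) s x.1 p x.2 (hA x (by simp))) ?_
    exact (ih fun y hy => hA y (by simp [hy])).lift (x :: ·) fun _ _ => ElemOp.cons x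

/-- Between two syllables of the same generator, a reduced expression has a syllable that does
not commute with them. -/
theorem Expression.IsMReduced.exists_ne_two {s : S} {p q : {p : ℤ // p ≠ 0}} {A V : Expression S}
    (h : Expression.IsMReduced M ((s, p) :: (A ++ (s, q) :: V))) : ∃ x ∈ A, M s x.1 ≠ 2 := by
  by_contra! hA
  have h1 := reflTransGen_swap s p A ((s, q) :: V) hA
  by_cases hpq : (p : ℤ) + q = 0
  · have := h _ (h1.tail (ElemOp.cancel A V s p q hpq))
    simp at this
  · have := h _ (h1.tail (ElemOp.merge A V s p q hpq))
    simp at this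

end Expressions

/-! ### Test arcs and their images under reduced expressions -/

/-- The arc that crosses the circle of `r` and no other circle of a vertex. -/
def testArc {S : Type*} (r : S) : FreeGroup (Letter S) :=
  ofList [(Sum.inr r, r, false), (Sum.inr r, r, true)]

theorem toWord_testArc {S : Type*} [LinearOrder S] (r : S) :
    (testArc r).toWord = [((Sum.inr r, r, false), true), ((Sum.inr r, r, true), true)] :=
  (isReduced_map_true [(Sum.inr r, r, false), (Sum.inr r, r, true)]).toWord_mk

theorem passes_testArc {S : Type*} [LinearOrder S] (r : S) :
    Passes (Sum.inr r, r, false) (Sum.inr r, r, true) (testArc r) :=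
  Or.inl (by rw [toWord_testArc])

theorem not_passes_testArc {S : Type*} [LinearOrder S] (r s u : S) :
    ¬ Passes (Sum.inl s, u, false) (Sum.inl s, u, true) (testArc r) := by
  rintro (h | h)
  · have := h.subset (List.mem_cons_self (a := ((Sum.inl s, u, false), true)))
    simp [toWord_testArc] at this
  · have := h.subset (List.mem_cons_self (a := ((Sum.inl s, u, false), true)))
    simp [toWord_inv, toWord_testArc, invRev] at this

section Injectivity

variable {S : Type*} [Fintype S] [LinearOrder S] {M : CoxeterMatrix S}

theorem twist_testArc {c : Equiv.Perm S} {s r : S} (k : ℤ) (h : r ≠ s) :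
    twist M c s k (testArc r) = testArc r := by
  refine map_ofList_eq_self fun x hx => twist_of_eq_self fun hx' => h ?_
  simp only [List.mem_cons, List.not_mem_nil, or_false] at hx
  rcases hx with rfl | rfl <;> exact hx'.1

/-- The endomorphism by which the image of an expression in the Artin group acts. -/
noncomputable def exprEnd (M : CoxeterMatrix S) (c : Equiv.Perm S) (m : S → ℕ)
    (W : Expression S) : Monoid.End (FreeGroup (Letter S)) :=
  (W.map fun x => twist M c x.1 (m x.1 * x.2)).prod

theorem exprEnd_cons (c : Equiv.Perm S) (m : S → ℕ) (x : S × {p : ℤ // p ≠ 0})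
    (W : Expression S) (g : FreeGroup (Letter S)) :
    exprEnd M c m (x :: W) g = twist M c x.1 (m x.1 * x.2) (exprEnd M c m W g) := by
  rw [exprEnd, List.map_cons, List.prod_cons]
  rfl

theorem coe_artinAction_powHom_eval (hM : IsSmallType M) {c : Equiv.Perm S}
    (hc : c.IsCycleOn Set.univ) (m : S → ℕ) (W : Expression S) :
    (artinAction hM hc (powHom M m (Expression.eval M W)) :
      Monoid.End (FreeGroup (Letter S))) = exprEnd M c m W := by
  induction W with
  | nil => simp [Expression.eval, exprEnd]
  | cons x W ih =>
    have e : Expression.eval M (x :: W) = genT M x.1 ^ (x.2 : ℤ) * Expression.eval M W := by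
      simp [Expression.eval]
    rw [e, map_mul, map_mul, Units.val_mul, ih, map_zpow, powHom_genT, ← zpow_natCast,
      ← zpow_mul, coe_artinAction_sigma_zpow]
    simp [exprEnd]

theorem exprEnd_testArc {c : Equiv.Perm S} (m : S → ℕ) {W : Expression S} {r : S}
    (h : ∀ x ∈ W, x.1 ≠ r) : exprEnd M c m W (testArc r) = testArc r := by
  induction W with
  | nil => rfl
  | cons x W ih =>
    rw [exprEnd_cons, ih fun y hy => h y (by simp [hy]),
      twist_testArc _ (h x (by simp)).symm]

/-- If `t` occurs in the reduced expression `W`, and `u` does not occur to the left of the first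
occurrence of `t`, then some test arc is moved to an element that runs through the point `u` of
the circle of `t`. -/
theorem exists_passes_exprEnd (hM : IsSmallType M) {c : Equiv.Perm S}
    (hc : c.IsCycleOn Set.univ) {m : S → ℕ} (hm : ∀ s, 2 ≤ m s) (W : Expression S)
    (hW : Expression.IsMReduced M W) (A B : Expression S) (t u : S) (q : {p : ℤ // p ≠ 0})
    (h : W = A ++ (t, q) :: B) (hA : ∀ x ∈ A, x.1 ≠ u) (hut : A = [] ∨ u ≠ t) :
    ∃ r, Passes (Sum.inl t, u, false) (Sum.inl t, u, true) (exprEnd M c m W (testArc r)) := by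
  induction W generalizing A B t u q with
  | nil => simp at h
  | cons y W ih =>
    have ih := ih hW.of_cons
    -- The leftmost syllable acts last. It suffices that the rest of the expression produces a pass
    -- across its circle; the twist then creates passes through every point `u`.
    have head : ∀ u, ∃ r, Passes (Sum.inl y.1, u, false) (Sum.inl y.1, u, true)
        (exprEnd M c m (y :: W) (testArc r)) := by
      intro u
      have hk : 2 ≤ ((m y.1 : ℤ) * (y.2 : ℤ)).natAbs := by
        rw [Int.natAbs_mul, Int.natAbs_natCast]
        have h1 := Int.natAbs_pos.2 y.2.2
        nlinarith [hm y.1]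
      by_cases hy : ∃ x ∈ W, x.1 = y.1
      · obtain ⟨x, hx, hxy⟩ := hy
        classical
        obtain ⟨x, A', B', hxy, hA', rfl⟩ : ∃ (x : S × {p : ℤ // p ≠ 0}) (A' B' : Expression S),
            x.1 = y.1 ∧ (∀ z ∈ A', z.1 ≠ y.1) ∧ W = A' ++ x :: B' := by
          have := List.exists_of_eraseP (p := fun z => decide (z.1 = y.1)) hx (by simpa using hxy)
          obtain ⟨a, l₁, l₂, h1, h2, h3, -⟩ := this
          exact ⟨a, l₁, l₂, by simpa using h2, fun z hz => by simpa using h1 z hz, h3⟩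
        obtain ⟨s, p⟩ := y
        obtain ⟨s', q⟩ := x
        obtain rfl : s' = s := hxy
        -- The circle of `z` crosses that of `s'`, and `s'` does not occur to the left of `z` in the
        -- rest, so the induction hypothesis applies to `z` at the point `s'`.
        obtain ⟨z, hz, hz2⟩ := hW.exists_ne_two
        have hzs := hA' z hz
        have hz3 : M z.1 s' = 3 := by
          rw [M.symmetric]
          exact (hM s' z.1 hzs.symm).resolve_left hz2
        obtain ⟨A₁, A₂, rfl⟩ := List.append_of_mem hz
        obtain ⟨r, hr⟩ := ih A₁ (A₂ ++ (s', q) :: B') z.1 s' z.2 (by simp)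
          (fun x hx => hA' x (by simp [hx])) (Or.inr hzs.symm)
        refine ⟨r, ?_⟩
        rw [exprEnd_cons]
        exact passes_twist_of_crosses hc hk (v := Sum.inl z.1) hz3 u hr
      · push Not at hy
        -- The generator does not occur in the rest, so its own test arc arrives unchanged and
        -- crosses its circle.
        refine ⟨y.1, ?_⟩
        rw [exprEnd_cons, exprEnd_testArc m hy]
        exact passes_twist_of_crosses hc hk (v := Sum.inr y.1) rfl u (passes_testArc y.1)
    cases A with
    | nil =>
      obtain ⟨rfl, rfl⟩ := List.cons.inj h
      exact head u
    | cons x A =>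
      obtain ⟨rfl, rfl⟩ := List.cons.inj h
      by_cases hyt : y.1 = t
      · subst hyt
        exact head u
      · have hut := hut.resolve_left (by simp)
        obtain ⟨r, hr⟩ := ih A B t u q rfl (fun z hz => hA z (by simp [hz])) (Or.inr hut)
        refine ⟨r, ?_⟩
        rw [exprEnd_cons]
        exact passes_twist _ (fun e => hyt (Sum.inl_injective e).symm) (hA y (by simp)).symm hr

end Injectivity

/-! ### Nontriviality, injectivity and the presentation -/

theorem powHom_eval_ne_one {S : Type*} [Finite S] {M : CoxeterMatrix S} (hM : IsSmallType M)
    {m : S → ℕ} (hm : ∀ s, 2 ≤ m s) {W : Expression S} (hne : W ≠ [])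
    (hW : Expression.IsMReduced M W) : powHom M m (Expression.eval M W) ≠ 1 := by
  classical
  cases nonempty_fintype S
  -- The order, which fixes the signs of the crossings, and the cyclic arrangement `c` of the points
  -- are arbitrary choices.
  let _ : LinearOrder S := LinearOrder.lift' _ (Fintype.equivFin S).injective
  obtain ⟨c, hc, -⟩ := Finset.exists_cycleOn (Finset.univ : Finset S)
  rw [Finset.coe_univ] at hc
  obtain ⟨⟨t, q⟩, B, rfl⟩ := List.exists_cons_of_ne_nil hne
  -- Any point of the circle of `t` would do, since the test arc contains no letter of a vertex
  -- circle.
  obtain ⟨r, hr⟩ := exists_passes_exprEnd hM hc hm _ hW [] B t t q rfl (by simp) (Or.inl rfl)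
  intro h
  rw [← coe_artinAction_powHom_eval hM hc, h, map_one] at hr
  exact not_passes_testArc r t t hr

theorem powHom_injective {S : Type*} [Finite S] {M : CoxeterMatrix S} (hM : IsSmallType M)
    {m : S → ℕ} (hm : ∀ s, 2 ≤ m s) : Function.Injective (powHom M m) := by
  refine (injective_iff_map_eq_one _).2 fun w hw => ?_
  obtain ⟨W, rfl⟩ := Expression.eval_surjective M w
  obtain ⟨W', h, e⟩ := Expression.exists_isMReduced M W
  rw [← e] at hw ⊢
  by_contra hne
  refine powHom_eval_ne_one hM hm ?_ h hw
  rintro rfl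
  exact hne rfl

theorem range_powHom {S : Type*} (M : CoxeterMatrix S) (m : S → ℕ) :
    (powHom M m).range = Subgroup.closure (Set.range fun s : S => sigma M s ^ m s) := by
  rw [MonoidHom.range_eq_map, ← PresentedGroup.closure_range_of, MonoidHom.map_closure,
    ← Set.range_comp]
  congr 2
  ext1 s
  exact powHom_genT M m s

theorem exists_mulEquiv_closure {S : Type*} [Finite S] {M : CoxeterMatrix S}
    (hM : IsSmallType M) {m : S → ℕ} (hm : ∀ s, 2 ≤ m s) :
    ∃ e : HGroup M ≃* Subgroup.closure (Set.range fun s : S => sigma M s ^ m s),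
      ∀ s : S, (e (genT M s) : ArtinGroup M) = sigma M s ^ m s :=
  ⟨(MonoidHom.ofInjective (powHom_injective hM hm)).trans
    (MulEquiv.subgroupCongr (range_powHom M m)), fun s => powHom_genT M m s⟩

end ArtinTits

theorem proposition7 {S : Type*} [Finite S] (M : CoxeterMatrix S)
    (hsmall : ArtinTits.IsSmallType M) (hconn : (ArtinTits.coxeterGraph M).Connected) :
    (∀ m : S → ℕ, (∀ s, 2 ≤ m s) →
      (∀ w : ArtinTits.HGroup M,
        (∃ W : ArtinTits.Expression S,
          W ≠ [] ∧ ArtinTits.Expression.IsMReduced M W ∧ ArtinTits.Expression.eval M W = w) →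
        ArtinTits.powHom M m w ≠ 1) ∧
      Function.Injective (ArtinTits.powHom M m) ∧
      ∃ e : ArtinTits.HGroup M ≃*
          Subgroup.closure (Set.range fun s : S => ArtinTits.sigma M s ^ m s),
        ∀ s : S, (e (ArtinTits.genT M s) : ArtinTits.ArtinGroup M) = ArtinTits.sigma M s ^ m s) ∧
    ∃ e : ArtinTits.HGroup M ≃*
        Subgroup.closure (Set.range fun s : S => ArtinTits.sigma M s ^ 2),
      ∀ s : S, (e (ArtinTits.genT M s) : ArtinTits.ArtinGroup M) = ArtinTits.sigma M s ^ 2 := by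
  refine ⟨fun m hm => ⟨?_, ArtinTits.powHom_injective hsmall hm,
    ArtinTits.exists_mulEquiv_closure hsmall hm⟩,
    ArtinTits.exists_mulEquiv_closure hsmall (m := fun _ => 2) fun _ => le_rfl⟩
  rintro w ⟨W, hne, hW, rfl⟩
  exact ArtinTits.powHom_eval_ne_one hsmall hm hne hW
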